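/- Theorem 2.1 (Rough asymptotics for cliques). Let $\tau\in(2,3)$ and let $l$ be a slowly varying function, i.e. $l$ is measurable and positive on some half-line $[X,\infty)$, $X>0$, and $l(cx)/l(x)\to1$ as $x\to\infty$ for every fixed $c>0$. Let $H$ be a random variable with values in $[1,\infty)$ and tail $$\overline F(h)=\mathbb P(H>h)=l(h)\,h^{1-\tau},\qquad h\ge 1,$$ and let $\mu=\mathbb E[H]$. For each $n$, consider the rank-1 inhomogeneous (Chung–Lu) random graph on $n$ vertices: the vertices have i.i.d. weights $h_1,\dots,h_n$ distributed as $H$ and, conditionally on the weights, distinct vertices $i\neq j$ are joined by an edge with probability $\min\left(\frac{h_ih_j}{\mu n},1\right)$, independently over the unordered pairs $\{i,j\}$. Let $A_k(n)$ be the expected number of $k$-cliques of this graph, i.e. of $k$-element sets of pairwise adjacent vertices. Then for every fixed integer $k\ge3$, $$A_k(n)\asymp n^k\,\overline F(\sqrt n)^k=n^{\frac k2(3-\tau)}\,l(\sqrt n)^k\qquad\text{as } n\to\infty,$$ where the equality holds for every $n\ge 1$, and $g_1(n)\asymp g_2(n)$ means that there are constants $C_1>0$ and $C_2<\infty$ (independent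 of $n$) with $$C_1\le\liminf_{n\to\infty}\frac{g_1(n)}{g_2(n)}\le\limsup_{n\to\infty}\frac{g_1(n)}{g_2(n)}\le C_2 .$$ -/

import Mathlib

open MeasureTheory Filter Topology

noncomputable section

namespace RankOneGraph

/-- A (Karamata) slowly varying function: defined and measurable and positive on some half-line
`[X, ∞)`, with `l (c x) / l x → 1` as `x → ∞` for every fixed `c > 0`. -/
def IsSlowlyVarying (l : ℝ → ℝ) : Prop :=
  (∃ X : ℝ, 0 < X ∧ Measurable ((Set.Ici X).domRestrict l) ∧ ∀ x, X ≤ x → 0 < l x) ∧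
    ∀ c : ℝ, 0 < c → Tendsto (fun x => l (c * x) / l x) atTop (𝓝 1)

/-- The relation `g₁ ≍ g₂` as `n → ∞`. The lower and upper limits are taken in the extended
reals, where they always exist. -/
def SameOrder (g₁ g₂ : ℕ → ℝ) : Prop :=
  ∃ C₁ C₂ : ℝ, 0 < C₁ ∧
    (C₁ : EReal) ≤ liminf (fun n => ((g₁ n / g₂ n : ℝ) : EReal)) atTop ∧
    liminf (fun n => ((g₁ n / g₂ n : ℝ) : EReal)) atTop ≤
      limsup (fun n => ((g₁ n / g₂ n : ℝ) : EReal)) atTop ∧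
    limsup (fun n => ((g₁ n / g₂ n : ℝ) : EReal)) atTop ≤ (C₂ : EReal)

/-- The tail `ℙ(H > h)` of the weight distribution `ν`. -/
def tail (ν : Measure ℝ) (h : ℝ) : ℝ := ν.real (Set.Ioi h)

/-- The average weight. -/
def meanWeight (ν : Measure ℝ) : ℝ := ∫ h, h ∂ν

/-- The connection probability of two vertices with weights `x` and `y` in the graph on `n`
vertices, `μ` being the average weight. -/
def connProb (μ : ℝ) (n : ℕ) (x y : ℝ) : ℝ := min (x * y / (μ * n)) 1

theorem connProb_comm (μ : ℝ) (n : ℕ) (x y : ℝ) : connProb μ n x y = connProb μ n y x := by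
  simp [connProb, mul_comm]

/-- The graph with vertex weights `h` in which the pair `{i, j}` is an edge when its mark
`u {i, j}` lies below the connection probability of `i` and `j`. -/
def graph (μ : ℝ) (n : ℕ) (h : Fin n → ℝ) (u : Sym2 (Fin n) → unitInterval) :
    SimpleGraph (Fin n) where
  Adj i j := i ≠ j ∧ ((u s(i, j) : unitInterval) : ℝ) < connProb μ n (h i) (h j)
  symm := ⟨fun i j hij => ⟨hij.1.symm, by
    rw [Sym2.eq_swap, connProb_comm]; exact hij.2⟩⟩
  loopless := ⟨fun _ hi => hi.1 rfl⟩

/-- The joint law of the `n` weights (i.i.d. with law `ν`) and of the marks of the pairs of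
vertices (i.i.d. uniform on `[0, 1]`, and independent of the weights). Under this law, given the
weights, the edges of `graph` are independent with the probabilities `connProb`. -/
def law (ν : Measure ℝ) (n : ℕ) : Measure ((Fin n → ℝ) × (Sym2 (Fin n) → unitInterval)) :=
  (Measure.pi fun _ : Fin n => ν).prod
    (Measure.pi fun _ : Sym2 (Fin n) => (volume : Measure unitInterval))

/-- The average number `A_k(n)` of `k`-cliques (sets of `k` pairwise adjacent vertices) of the
random graph on `n` vertices with weight distribution `ν`. -/
def avgCliques (ν : Measure ℝ) (k n : ℕ) : ℝ :=
  ∫ ω, (((graph (meanWeight ν) n ω.1 ω.2).cliqueSet k).ncard : ℝ) ∂(law ν n)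

end RankOneGraph

end

/-! The count is dominated by cliques whose vertices all have weight of order `√n`. Lower bound:
vertices of weight above `√(μ n)` are joined with probability one, so each `k`-set is a clique with
probability at least `tail ν √(μ n) ^ k`. Regular variation replaces `√(μ n)` by `√n` at the price
of a constant, and there are at least of the order `n ^ k` such sets. Upper bound: put `x i = h i /
√(μ n)`, so that an edge has probability `min (x i * x j) 1`. The key is the deterministic
inequality `sum_pairs_le`: for at least three vertices, the product of these over all pairs is at
most the product over the vertices of `min (x i ^ a) (x i ^ b)`, for suitable `b < τ - 1 < a`.
Independence of the weights then factorizes the expectation (`law_cliqueEvent_le`). A Karamata-type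
estimate (`exists_lintegral_min_rpow_le`) bounds each factor by a constant times the tail at `√(μ
n)`: the exponent `a` makes the part below the threshold converge, and `b` the part above. -/

open MeasureTheory Filter Topology

noncomputable section

namespace RankOneGraph

/-! ### Dominating edge sums by vertex sums. -/

section EdgeSums

variable {V : Type*} [DecidableEq V]

/-- The two-element subsets of `s`. -/
def pairs (s : Finset V) : Finset (Sym2 V) := s.sym2.filter fun e => ¬ e.IsDiag

theorem mk_mem_pairs {s : Finset V} {i j : V} : s(i, j) ∈ pairs s ↔ i ∈ s ∧ j ∈ s ∧ i ≠ j := by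
  simp [pairs, and_assoc]

@[simp]
theorem pairs_empty : pairs (∅ : Finset V) = ∅ := by simp [pairs]

theorem pairs_insert {a : V} {s : Finset V} (ha : a ∉ s) :
    pairs (insert a s) = s.image (fun b => s(a, b)) ∪ pairs s := by
  ext e
  induction e with
  | _ i j =>
    simp only [Finset.mem_union, mk_mem_pairs, Finset.mem_image, Finset.mem_insert, Sym2.eq_iff]
    constructor
    · rintro ⟨rfl | hi, rfl | hj, hij⟩
      · exact absurd rfl hij
      · exact Or.inl ⟨j, hj, Or.inl ⟨rfl, rfl⟩⟩
      · exact Or.inl ⟨i, hi, Or.inr ⟨rfl, rfl⟩⟩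
      · exact Or.inr ⟨hi, hj, hij⟩
    · rintro (⟨b, hb, ⟨rfl, rfl⟩ | ⟨rfl, rfl⟩⟩ | ⟨hi, hj, hij⟩)
      · exact ⟨Or.inl rfl, Or.inr hb, fun h => ha (h ▸ hb)⟩
      · exact ⟨Or.inr hb, Or.inl rfl, fun h => ha (h ▸ hb)⟩
      · exact ⟨Or.inr hi, Or.inr hj, hij⟩

theorem sum_pairs_insert {M : Type*} [AddCommMonoid M] {a : V} {s : Finset V} (ha : a ∉ s)
    (w : Sym2 V → M) :
    ∑ e ∈ pairs (insert a s), w e = ∑ b ∈ s, w s(a, b) + ∑ e ∈ pairs s, w e := by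
  rw [pairs_insert ha, Finset.sum_union, Finset.sum_image]
  · intro b _ c _ h
    have h' : s(a, b) = s(a, c) := h
    simp only [Sym2.congr_right] at h'
    exact h'
  · rw [Finset.disjoint_left]
    intro e he he'
    obtain ⟨b, hb, rfl⟩ := Finset.mem_image.1 he
    exact ha (mk_mem_pairs.1 he').1

/-- Split by the signs of the three variables. With all of them negative, `a ≤ 2` suffices; one
negative variable needs `a ≤ 2 * b`, and two need `2 * (a - 1) ≤ b`. -/
theorem triangle_bound {a b : ℝ} (hb : 0 ≤ b) (hba : b ≤ a) (ha : a ≤ 2) (hab : 2 * (a - 1) ≤ b)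
    (hab' : a ≤ 2 * b) (x y z : ℝ) :
    min (x + y) 0 + min (x + z) 0 + min (y + z) 0 ≤
      min (a * x) (b * x) + min (a * y) (b * y) + min (a * z) (b * z) := by
  have hm : ∀ t : ℝ, t ≤ 0 → min (a * t) (b * t) = a * t := fun t ht =>
    min_eq_left (by nlinarith)
  have hp : ∀ t : ℝ, 0 ≤ t → min (a * t) (b * t) = b * t := fun t ht =>
    min_eq_right (by nlinarith)
  have ha0 : 0 ≤ a := hb.trans hba
  -- One negative variable `v`: its term `a * v` is shared equally between its two edges.
  have hhalf : ∀ p q v : ℝ, 0 ≤ p → 0 ≤ q → v ≤ 0 →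
      min (p + v) 0 + min (q + v) 0 ≤ b * p + b * q + a * v := by
    intro p q v hp hq hv
    have key : ∀ t : ℝ, 0 ≤ t → min (t + v) 0 ≤ b * t + a / 2 * v := by
      intro t ht
      rcases le_total (t + v) 0 with h | h
      · rw [min_eq_left h]; nlinarith
      · rw [min_eq_right h]; nlinarith
    linarith [key p hp, key q hq]
  -- Two negative variables: their common edge uses up `v + w`, leaving `a - 1` of each for its edge
  -- to `p`, while `b * p` is shared equally.
  have htwo : ∀ p v w : ℝ, 0 ≤ p → v ≤ 0 → w ≤ 0 →
      min (p + v) 0 + min (p + w) 0 + (v + w) ≤ b * p + a * v + a * w := by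
    intro p v w hp hv hw
    have key : ∀ t : ℝ, t ≤ 0 → min (p + t) 0 ≤ b / 2 * p + (a - 1) * t := by
      intro t ht
      rcases le_total (p + t) 0 with h | h
      · rw [min_eq_left h]
        rcases le_total 1 a with h1 | h1 <;> nlinarith
      · rw [min_eq_right h]
        rcases le_total 1 a with h1 | h1 <;> nlinarith [mul_nonneg hb hp]
    linarith [key v hv, key w hw]
  rcases le_total x 0 with hx | hx <;> rcases le_total y 0 with hy | hy <;>
    rcases le_total z 0 with hz | hz
  · rw [hm x hx, hm y hy, hm z hz, min_eq_left (by linarith), min_eq_left (by linarith),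
      min_eq_left (by linarith)]
    nlinarith
  · rw [hm x hx, hm y hy, hp z hz, min_eq_left (add_nonpos hx hy), add_comm x z, add_comm y z]
    linarith [htwo z x y hz hx hy]
  · rw [hm x hx, hp y hy, hm z hz, min_eq_left (add_nonpos hx hz), add_comm x y]
    linarith [htwo y x z hy hx hz]
  · rw [hm x hx, hp y hy, hp z hz, min_eq_right (add_nonneg hy hz), add_comm x y, add_comm x z]
    linarith [hhalf y z x hy hz hx]
  · rw [hp x hx, hm y hy, hm z hz, min_eq_left (add_nonpos hy hz)]
    linarith [htwo x y z hx hy hz]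
  · rw [hp x hx, hm y hy, hp z hz, min_eq_right (add_nonneg hx hz), add_comm y z]
    linarith [hhalf x z y hx hz hy]
  · rw [hp x hx, hp y hy, hm z hz, min_eq_right (add_nonneg hx hy)]
    linarith [hhalf x y z hx hy hz]
  · rw [hp x hx, hp y hy, hp z hz, min_eq_right (add_nonneg hx hy),
      min_eq_right (add_nonneg hx hz), min_eq_right (add_nonneg hy hz)]
    nlinarith [mul_nonneg hb hx, mul_nonneg hb hy, mul_nonneg hb hz]

/-- In a clique on at least three vertices the (logarithmic) edge weights are dominated by a sum
of vertex weights. -/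
theorem sum_pairs_le {a b : ℝ} (hb : 0 ≤ b) (hba : b ≤ a) (ha : a ≤ 2) (hab : 2 * (a - 1) ≤ b)
    (hab' : a ≤ 2 * b) (u : V → ℝ) (w : Sym2 V → ℝ) (hw : ∀ i j, w s(i, j) = min (u i + u j) 0)
    {m : ℕ} (hm : 3 ≤ m) (s : Finset V) (hs : s.card = m) :
    ∑ e ∈ pairs s, w e ≤ ∑ i ∈ s, min (a * u i) (b * u i) := by
  induction m, hm using Nat.le_induction generalizing s with
  | base =>
    obtain ⟨x, y, z, hxy, hxz, hyz, rfl⟩ := Finset.card_eq_three.1 hs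
    have h1 : x ∉ ({y, z} : Finset V) := by simp [hxy, hxz]
    have h2 : y ∉ ({z} : Finset V) := by simp [hyz]
    have h3 : ∑ e ∈ pairs ({z} : Finset V), w e = 0 := by
      have := sum_pairs_insert (Finset.notMem_empty z) w
      simpa using this
    rw [sum_pairs_insert h1, sum_pairs_insert h2, h3, Finset.sum_insert h1, Finset.sum_insert h2,
      Finset.sum_insert h2]
    simp only [Finset.sum_singleton, hw]
    linarith [triangle_bound hb hba ha hab hab' (u x) (u y) (u z)]
  | succ m hm ih =>
    by_cases hpos : ∃ i ∈ s, 0 ≤ u i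
    -- Deleting a vertex with `0 ≤ u i` discards nonpositive edge terms and a nonnegative vertex
    -- term.
    · obtain ⟨i, hi, hui⟩ := hpos
      rw [← Finset.insert_erase hi, sum_pairs_insert (Finset.notMem_erase i s),
        Finset.sum_insert (Finset.notMem_erase i s)]
      refine add_le_add ?_ (ih _ (by rw [Finset.card_erase_of_mem hi, hs]; rfl))
      refine (Finset.sum_nonpos fun j _ => ?_).trans (le_min ?_ ?_)
      · rw [hw]; exact min_le_right _ _
      · exact mul_nonneg (hb.trans hba) hui
      · exact mul_nonneg hb hui
    -- If all `u` are negative, the `m` edges at any vertex `i` contribute at most `m * u i ≤ a * u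
    -- i`, since `a ≤ 2 < m`.
    · push Not at hpos
      obtain ⟨i, hi⟩ : s.Nonempty := Finset.card_pos.1 (by omega)
      have hcard : (s.erase i).card = m := by rw [Finset.card_erase_of_mem hi, hs]; rfl
      have hui := hpos i hi
      rw [← Finset.insert_erase hi, sum_pairs_insert (Finset.notMem_erase i s),
        Finset.sum_insert (Finset.notMem_erase i s)]
      refine add_le_add ?_ (ih _ hcard)
      have h1 : ∑ j ∈ s.erase i, w s(i, j) ≤ ∑ _j ∈ s.erase i, u i := by
        refine Finset.sum_le_sum fun j hj => ?_
        rw [hw]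
        exact (min_le_left _ _).trans (by linarith [hpos j (Finset.mem_of_mem_erase hj)])
      rw [Finset.sum_const, hcard, nsmul_eq_mul] at h1
      rw [min_eq_left (by nlinarith)]
      have h2 : (3 : ℝ) ≤ m := by exact_mod_cast hm
      nlinarith

end EdgeSums

/-! ### Truncated moments of a regularly varying tail. -/

section Karamata

/-- The measure with density `h ^ p` with respect to `ν`. -/
def momentMeasure (ν : Measure ℝ) (p : ℝ) : Measure ℝ :=
  ν.withDensity fun h => ENNReal.ofReal (h ^ p)

theorem measurable_ofReal_rpow (p : ℝ) : Measurable fun h : ℝ => ENNReal.ofReal (h ^ p) :=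
  (measurable_id.pow_const p).ennreal_ofReal

variable {ν : Measure ℝ}

theorem momentMeasure_Ioc_le {p : ℝ} (hp : 0 ≤ p) {s t : ℝ} (hs : 0 ≤ s) :
    momentMeasure ν p (Set.Ioc s t) ≤ ENNReal.ofReal (t ^ p) * ν (Set.Ioi s) := by
  rw [momentMeasure, withDensity_apply _ measurableSet_Ioc]
  calc ∫⁻ h in Set.Ioc s t, ENNReal.ofReal (h ^ p) ∂ν
      ≤ ∫⁻ _h in Set.Ioc s t, ENNReal.ofReal (t ^ p) ∂ν :=
        setLIntegral_mono measurable_const fun h hh =>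
          ENNReal.ofReal_le_ofReal (Real.rpow_le_rpow (hs.trans hh.1.le) hh.2 hp)
    _ = ENNReal.ofReal (t ^ p) * ν (Set.Ioc s t) := by rw [setLIntegral_const]
    _ ≤ _ := by gcongr; exact Set.Ioc_subset_Ioi_self

theorem tail_nonneg (t : ℝ) : 0 ≤ tail ν t := measureReal_nonneg

theorem lintegral_le_Ioc_add_Ioi (hν : ∀ᵐ h ∂ν, 0 < h) (f : ℝ → ENNReal) (t : ℝ) :
    ∫⁻ h, f h ∂ν ≤ ∫⁻ h in Set.Ioc 0 t, f h ∂ν + ∫⁻ h in Set.Ioi t, f h ∂ν := by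
  have hae : ∀ᵐ h ∂ν, h ∈ Set.Ioc 0 t ∪ Set.Ioi t := by
    filter_upwards [hν] with h hh
    rcases le_or_gt h t with h' | h'
    · exact Or.inl ⟨hh, h'⟩
    · exact Or.inr h'
  calc ∫⁻ h, f h ∂ν = ∫⁻ h in Set.Ioc 0 t ∪ Set.Ioi t, f h ∂ν := by
        rw [Measure.restrict_eq_self_of_ae_mem hae]
    _ ≤ _ := lintegral_union_le _ _ _

variable [IsProbabilityMeasure ν]

theorem tail_le_one (t : ℝ) : tail ν t ≤ 1 := measureReal_le_one

theorem tail_antitone : Antitone (tail ν) := fun _ _ h =>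
  measureReal_mono (Set.Ioi_subset_Ioi h)

theorem measure_Ioi_eq (t : ℝ) : ν (Set.Ioi t) = ENNReal.ofReal (tail ν t) := by
  rw [tail, ofReal_measureReal]

theorem momentMeasure_Ioc_le_ofReal {p : ℝ} (hp : 0 ≤ p) {s t : ℝ} (hs : 0 ≤ s) (ht : 0 ≤ t) :
    momentMeasure ν p (Set.Ioc s t) ≤ ENNReal.ofReal (t ^ p * tail ν s) := by
  rw [ENNReal.ofReal_mul (Real.rpow_nonneg ht p), ← measure_Ioi_eq]
  exact momentMeasure_Ioc_le hp hs

/-- Every `t ≥ T` is `2 ^ m * s` for some `s ∈ [T, 2 T)`: an induction principle. -/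
theorem dyadic_induction {T : ℝ} (hT : 0 < T) {P : ℝ → Prop}
    (base : ∀ t, T ≤ t → t ≤ 2 * T → P t) (step : ∀ t, T ≤ t → P t → P (2 * t)) :
    ∀ t, T ≤ t → P t := by
  have key : ∀ m : ℕ, ∀ t, T ≤ t → t ≤ 2 ^ m * (2 * T) → P t := by
    intro m
    induction m with
    | zero => intro t h1 h2; exact base t h1 (by simpa using h2)
    | succ m ih =>
      intro t h1 h2
      rcases le_total t (2 * T) with h | h
      · exact base t h1 h
      · have := step (t / 2) (by linarith) (ih _ (by linarith) (by rw [pow_succ] at h2; linarith))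
        rwa [mul_div_cancel₀ _ two_ne_zero] at this
  intro t ht
  obtain ⟨m, hm⟩ := pow_unbounded_of_one_lt (t / (2 * T)) (one_lt_two (α := ℝ))
  exact key m t ht (((div_lt_iff₀ (by positivity)).1 hm).le)

/-- A moment of high order is, when truncated at `t`, of order `t ^ a * tail ν t`. -/
theorem exists_momentMeasure_Ioc_le {α a : ℝ} (ha : 0 ≤ a) (haα : α < a)
    (hpos : ∀ᶠ t in atTop, 0 < tail ν t)
    (hlim : Tendsto (fun t => tail ν (2 * t) / tail ν t) atTop (𝓝 ((2 : ℝ) ^ (-α)))) :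
    ∃ K T : ℝ, 0 < K ∧ 0 < T ∧ ∀ t, T ≤ t →
      momentMeasure ν a (Set.Ioc 0 t) ≤ ENNReal.ofReal (K * (t ^ a * tail ν t)) := by
  -- With `2 ^ (-a) < r < 2 ^ (-α)`, doubling `t` eventually multiplies `t ^ a * tail ν t` by at
  -- least `r * 2 ^ a > 1`, so the dyadic blocks sum like a geometric series dominated by the last
  -- one.
  obtain ⟨r, hr1, hr2⟩ := exists_between
    (Real.rpow_lt_rpow_of_exponent_lt one_lt_two (neg_lt_neg haα))
  have hr0 : 0 < r := (Real.rpow_pos_of_pos two_pos _).trans hr1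
  have hra : 1 < r * 2 ^ a := by
    rwa [Real.rpow_neg two_pos.le, inv_lt_iff_one_lt_mul₀ (by positivity)] at hr1
  obtain ⟨T, hT⟩ := eventually_atTop.1 ((hlim.eventually (lt_mem_nhds hr2)).and
    (hpos.and (eventually_gt_atTop 0)))
  have hT0 : 0 < T := (hT T le_rfl).2.2
  have hG : 0 < tail ν (2 * T) := (hT (2 * T) (by linarith)).2.1
  have hTa : 0 < T ^ a := Real.rpow_pos_of_pos hT0 a
  -- The first entry covers `[T, 2 * T]`; the second makes `K + 2 ^ a ≤ K * (r * 2 ^ a)`, which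
  -- closes the doubling step.
  set K : ℝ := max ((2 * T) ^ a / (T ^ a * tail ν (2 * T))) (2 ^ a / (r * 2 ^ a - 1)) with hK
  have hK0 : 0 < K := lt_max_of_lt_left (by positivity)
  have hK1 : (2 * T) ^ a ≤ K * (T ^ a * tail ν (2 * T)) :=
    (div_le_iff₀ (by positivity)).1 (le_max_left _ _)
  have hK2 : 2 ^ a ≤ K * (r * 2 ^ a - 1) :=
    (div_le_iff₀ (by linarith)).1 (le_max_right _ _)
  refine ⟨K, T, hK0, hT0, dyadic_induction hT0 ?_ ?_⟩
  · intro t h1 h2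
    have ht0 : 0 < t := hT0.trans_le h1
    refine (momentMeasure_Ioc_le_ofReal ha le_rfl ht0.le).trans (ENNReal.ofReal_le_ofReal ?_)
    calc t ^ a * tail ν 0 ≤ (2 * T) ^ a * 1 :=
          mul_le_mul (Real.rpow_le_rpow ht0.le h2 ha) (tail_le_one 0) (tail_nonneg 0)
            (by positivity)
      _ ≤ K * (T ^ a * tail ν (2 * T)) := by rw [mul_one]; exact hK1
      _ ≤ K * (t ^ a * tail ν t) := by
          gcongr
          exact tail_antitone h2
  · intro t h1 ih
    have ht0 : 0 < t := hT0.trans_le h1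
    have hGt := (hT t h1).2.1
    have hr : r * tail ν t ≤ tail ν (2 * t) := ((lt_div_iff₀ hGt).1 (hT t h1).1).le
    have hta : 0 < t ^ a := Real.rpow_pos_of_pos ht0 a
    rw [← Set.Ioc_union_Ioc_eq_Ioc ht0.le (by linarith : t ≤ 2 * t)]
    refine (measure_union_le _ _).trans ((add_le_add ih
      (momentMeasure_Ioc_le_ofReal ha ht0.le (by linarith))).trans ?_)
    rw [← ENNReal.ofReal_add (by positivity) (by positivity)]
    refine ENNReal.ofReal_le_ofReal ?_
    rw [Real.mul_rpow two_pos.le ht0.le]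
    calc K * (t ^ a * tail ν t) + 2 ^ a * t ^ a * tail ν t
        = (K + 2 ^ a) * (t ^ a * tail ν t) := by ring
      _ ≤ (K * (r * 2 ^ a)) * (t ^ a * tail ν t) := by
          gcongr; linarith
      _ = K * (2 ^ a * t ^ a * (r * tail ν t)) := by ring
      _ ≤ _ := by gcongr

/-- A moment of low order is, when restricted to `(t, ∞)`, of order `t ^ b * tail ν t`. -/
theorem exists_momentMeasure_Ioi_le {α b : ℝ} (hb : 0 ≤ b) (hbα : b < α)
    (hpos : ∀ᶠ t in atTop, 0 < tail ν t)
    (hlim : Tendsto (fun t => tail ν (2 * t) / tail ν t) atTop (𝓝 ((2 : ℝ) ^ (-α)))) :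
    ∃ K T : ℝ, 0 < K ∧ 0 < T ∧ ∀ t, T ≤ t →
      momentMeasure ν b (Set.Ioi t) ≤ ENNReal.ofReal (K * (t ^ b * tail ν t)) := by
  obtain ⟨r, hr1, hr2⟩ := exists_between
    (Real.rpow_lt_rpow_of_exponent_lt one_lt_two (neg_lt_neg hbα))
  have hr0 : 0 < r := (Real.rpow_pos_of_pos two_pos _).trans hr1
  have hrb : r * 2 ^ b < 1 := by
    rwa [Real.rpow_neg two_pos.le, lt_inv_comm₀ hr0 (by positivity), ← one_div,
      lt_div_iff₀ hr0, mul_comm] at hr2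
  obtain ⟨T, hT⟩ := eventually_atTop.1 ((hlim.eventually (gt_mem_nhds hr1)).and
    (hpos.and (eventually_gt_atTop 0)))
  have hT0 : 0 < T := (hT T le_rfl).2.2
  -- The sum of the geometric series of ratio `r * 2 ^ b < 1`, that is, the solution of `K = 2 ^ b +
  -- K * (r * 2 ^ b)`.
  set K : ℝ := 2 ^ b / (1 - r * 2 ^ b) with hK
  have hK0 : 0 < K := div_pos (by positivity) (by linarith)
  have hK2 : 2 ^ b = K * (1 - r * 2 ^ b) := by
    rw [hK, div_mul_cancel₀ _ (by linarith)]
  refine ⟨K, T, hK0, hT0, ?_⟩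
  -- The bound is uniform in `N`, so it passes to the increasing union. The induction peels off the
  -- first block and restarts at `2 * t`, hence the quantifier over `t`.
  have key : ∀ N : ℕ, ∀ t, T ≤ t →
      momentMeasure ν b (Set.Ioc t (2 ^ N * t)) ≤ ENNReal.ofReal (K * (t ^ b * tail ν t)) := by
    intro N
    induction N with
    | zero => intro t _; simp
    | succ N ih =>
      intro t h1
      have ht0 : 0 < t := hT0.trans_le h1
      have hGt := (hT t h1).2.1
      have hr : tail ν (2 * t) ≤ r * tail ν t := ((div_lt_iff₀ hGt).1 (hT t h1).1).le
      have htb : 0 < t ^ b := Real.rpow_pos_of_pos ht0 b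
      have hsub : Set.Ioc t (2 ^ (N + 1) * t) ⊆
          Set.Ioc t (2 * t) ∪ Set.Ioc (2 * t) (2 ^ N * (2 * t)) := by
        intro x hx
        rcases le_or_gt x (2 * t) with h | h
        · exact Or.inl ⟨hx.1, h⟩
        · exact Or.inr ⟨h, hx.2.trans_eq (by ring)⟩
      refine (measure_mono hsub).trans ((measure_union_le _ _).trans ((add_le_add
        (momentMeasure_Ioc_le_ofReal hb ht0.le (by linarith))
        (ih (2 * t) (by linarith))).trans ?_))
      have hG2 : 0 ≤ tail ν (2 * t) := tail_nonneg _
      rw [← ENNReal.ofReal_add (by positivity) (by positivity)]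
      refine ENNReal.ofReal_le_ofReal ?_
      rw [Real.mul_rpow two_pos.le ht0.le]
      calc 2 ^ b * t ^ b * tail ν t + K * (2 ^ b * t ^ b * tail ν (2 * t))
          ≤ 2 ^ b * t ^ b * tail ν t + K * (2 ^ b * t ^ b * (r * tail ν t)) := by gcongr
        _ = (2 ^ b + K * (r * 2 ^ b)) * (t ^ b * tail ν t) := by ring
        _ = _ := by rw [show 2 ^ b + K * (r * 2 ^ b) = K by linarith]
  intro t h1
  have ht0 : 0 < t := hT0.trans_le h1
  have hU : Set.Ioi t = ⋃ N : ℕ, Set.Ioc t (2 ^ N * t) := by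
    ext x
    simp only [Set.mem_Ioi, Set.mem_iUnion, Set.mem_Ioc, exists_and_left, iff_self_and]
    intro _
    obtain ⟨N, hN⟩ := pow_unbounded_of_one_lt (x / t) (one_lt_two (α := ℝ))
    exact ⟨N, ((div_lt_iff₀ ht0).1 hN).le⟩
  have hmono : Monotone fun N : ℕ => Set.Ioc t (2 ^ N * t) := by
    intro m n hmn
    refine Set.Ioc_subset_Ioc_right ?_
    gcongr
    exact one_le_two
  rw [hU, hmono.measure_iUnion]
  exact iSup_le fun N => key N t h1

/-- The expectation of `min ((H / t) ^ a) ((H / t) ^ b)`, with `a` above and `b` below the tail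
exponent, is of the order of the tail at `t`. -/
theorem exists_lintegral_min_rpow_le {α a b : ℝ} (hb : 0 ≤ b) (hbα : b < α) (haα : α < a)
    (hν : ∀ᵐ h ∂ν, 0 < h) (hpos : ∀ᶠ t in atTop, 0 < tail ν t)
    (hlim : Tendsto (fun t => tail ν (2 * t) / tail ν t) atTop (𝓝 ((2 : ℝ) ^ (-α)))) :
    ∃ K : ℝ, 0 < K ∧ ∀ᶠ t in atTop,
      ∫⁻ h, ENNReal.ofReal (min ((h / t) ^ a) ((h / t) ^ b)) ∂ν ≤
        ENNReal.ofReal (K * tail ν t) := by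
  obtain ⟨K₁, T₁, hK₁, hT₁, h₁⟩ :=
    exists_momentMeasure_Ioc_le (hb.trans (hbα.trans haα).le) haα hpos hlim
  obtain ⟨K₂, T₂, hK₂, hT₂, h₂⟩ := exists_momentMeasure_Ioi_le hb hbα hpos hlim
  refine ⟨K₁ + K₂, by positivity, ?_⟩
  filter_upwards [eventually_ge_atTop T₁, eventually_ge_atTop T₂] with t ht₁ ht₂
  have ht0 : 0 < t := hT₁.trans_le ht₁
  have hG : 0 ≤ tail ν t := tail_nonneg t
  have hscale : ∀ (p K : ℝ) (s : Set ℝ), MeasurableSet s → (∀ h ∈ s, 0 ≤ h) →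
      momentMeasure ν p s ≤ ENNReal.ofReal (K * (t ^ p * tail ν t)) →
      ∫⁻ h in s, ENNReal.ofReal ((h / t) ^ p) ∂ν ≤ ENNReal.ofReal (K * tail ν t) := by
    intro p K s hs hs0 hle
    have htp : 0 < t ^ p := Real.rpow_pos_of_pos ht0 p
    calc ∫⁻ h in s, ENNReal.ofReal ((h / t) ^ p) ∂ν
        = ∫⁻ h in s, ENNReal.ofReal (t ^ p)⁻¹ * ENNReal.ofReal (h ^ p) ∂ν := by
          refine setLIntegral_congr_fun hs fun h hh => ?_
          rw [← ENNReal.ofReal_mul (by positivity), Real.div_rpow (hs0 h hh) ht0.le,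
            div_eq_inv_mul]
      _ = ENNReal.ofReal (t ^ p)⁻¹ * momentMeasure ν p s := by
          rw [lintegral_const_mul _ (measurable_ofReal_rpow p), momentMeasure,
            withDensity_apply _ hs]
      _ ≤ ENNReal.ofReal (t ^ p)⁻¹ * ENNReal.ofReal (K * (t ^ p * tail ν t)) := by gcongr
      _ = _ := by
          rw [← ENNReal.ofReal_mul (by positivity)]
          congr 1
          field_simp
  refine (lintegral_le_Ioc_add_Ioi hν _ t).trans ?_
  rw [add_mul, ENNReal.ofReal_add (by positivity) (by positivity)]
  refine add_le_add ?_ ?_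
  · refine (lintegral_mono fun h => ENNReal.ofReal_le_ofReal (min_le_left _ _)).trans
      (hscale a K₁ _ measurableSet_Ioc (fun h hh => hh.1.le) (h₁ t ht₁))
  · refine (lintegral_mono fun h => ENNReal.ofReal_le_ofReal (min_le_right _ _)).trans
      (hscale b K₂ _ measurableSet_Ioi (fun h hh => (ht0.trans hh).le) (h₂ t ht₂))

/-- The first moment is of low order because `1 < α`, so its part beyond a large threshold is
finite. -/
theorem integrable_id_of_tail {α : ℝ} (hα : 1 < α) (hν : ∀ᵐ h ∂ν, 0 < h)
    (hpos : ∀ᶠ t in atTop, 0 < tail ν t)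
    (hlim : Tendsto (fun t => tail ν (2 * t) / tail ν t) atTop (𝓝 ((2 : ℝ) ^ (-α)))) :
    Integrable (fun h : ℝ => h) ν := by
  obtain ⟨K, T, -, hT, h⟩ := exists_momentMeasure_Ioi_le zero_le_one hα hpos hlim
  refine ⟨measurable_id.aestronglyMeasurable, ?_⟩
  rw [hasFiniteIntegral_iff_ofReal (hν.mono fun _ h => h.le)]
  refine (lintegral_le_Ioc_add_Ioi hν _ T).trans_lt (ENNReal.add_lt_top.2 ⟨?_, ?_⟩)
  · have := momentMeasure_Ioc_le_ofReal (ν := ν) zero_le_one le_rfl hT.le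
    rw [momentMeasure, withDensity_apply _ measurableSet_Ioc] at this
    simp only [Real.rpow_one] at this
    exact this.trans_lt ENNReal.ofReal_lt_top
  · have := h T le_rfl
    rw [momentMeasure, withDensity_apply _ measurableSet_Ioi] at this
    simp only [Real.rpow_one] at this
    exact this.trans_lt ENNReal.ofReal_lt_top

end Karamata

/-! ### Probability that a given vertex set is a clique. -/

section Cliques

/-- The event that the vertices in `s` are pairwise adjacent. -/
def cliqueEvent (μ : ℝ) (n : ℕ) (s : Finset (Fin n)) :
    Set ((Fin n → ℝ) × (Sym2 (Fin n) → unitInterval)) :=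
  {ω | (graph μ n ω.1 ω.2).IsClique s}

theorem mem_cliqueEvent {μ : ℝ} {n : ℕ} {s : Finset (Fin n)}
    {ω : (Fin n → ℝ) × (Sym2 (Fin n) → unitInterval)} :
    ω ∈ cliqueEvent μ n s ↔ ∀ i ∈ s, ∀ j ∈ s, i ≠ j →
      ((ω.2 s(i, j) : unitInterval) : ℝ) < connProb μ n (ω.1 i) (ω.1 j) := by
  refine forall₂_congr fun i _ => forall₂_congr fun j _ => forall_congr' fun hij => ?_
  exact and_iff_right hij

theorem measurableSet_cliqueEvent (μ : ℝ) (n : ℕ) (s : Finset (Fin n)) :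
    MeasurableSet (cliqueEvent μ n s) := by
  have : cliqueEvent μ n s = ⋂ i ∈ s, ⋂ j ∈ s, ⋂ (_ : i ≠ j),
      {ω | ((ω.2 s(i, j) : unitInterval) : ℝ) < connProb μ n (ω.1 i) (ω.1 j)} := by
    ext ω
    simp only [mem_cliqueEvent, Set.mem_iInter, Set.mem_ofPred_eq]
  rw [this]
  refine s.measurableSet_biInter fun i _ => s.measurableSet_biInter fun j _ =>
    MeasurableSet.iInter fun _ => measurableSet_lt ?_ ?_
  · exact measurable_subtype_coe.comp ((measurable_pi_apply _).comp measurable_snd)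
  · unfold connProb
    fun_prop

variable {ν : Measure ℝ} [IsProbabilityMeasure ν]

instance (n : ℕ) : IsProbabilityMeasure (law ν n) := by
  unfold law; infer_instance

open scoped Classical in
theorem ncard_cliqueSet {n : ℕ} (G : SimpleGraph (Fin n)) (k : ℕ) :
    ((G.cliqueSet k).ncard : ℝ) =
      ∑ s ∈ Finset.powersetCard k (Finset.univ : Finset (Fin n)),
        if G.IsClique (s : Set (Fin n)) then 1 else 0 := by
  have : G.cliqueSet k =
      ((Finset.powersetCard k Finset.univ).filter fun s : Finset (Fin n) => G.IsClique s) := by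
    ext s
    simp [SimpleGraph.mem_cliqueSet_iff, SimpleGraph.isNClique_iff, and_comm]
  rw [this, Set.ncard_coe_finset, Finset.card_filter]
  push_cast
  rfl

theorem avgCliques_eq_sum (k n : ℕ) :
    avgCliques ν k n =
      ∑ s ∈ Finset.powersetCard k Finset.univ, (law ν n).real (cliqueEvent (meanWeight ν) n s) := by
  have h : ∀ ω, ((((graph (meanWeight ν) n ω.1 ω.2).cliqueSet k).ncard : ℕ) : ℝ) =
      ∑ s ∈ Finset.powersetCard k Finset.univ,
        (cliqueEvent (meanWeight ν) n s).indicator 1 ω := fun ω => by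
    rw [ncard_cliqueSet]
    refine Finset.sum_congr rfl fun s _ => ?_
    classical
    rw [Set.indicator_apply]
    exact if_congr Iff.rfl rfl rfl
  simp only [avgCliques, h]
  rw [integral_finsetSum]
  · exact Finset.sum_congr rfl fun s _ => integral_indicator_one (measurableSet_cliqueEvent _ _ _)
  · intro s _
    exact (integrable_const 1).indicator (measurableSet_cliqueEvent _ _ _)

theorem volume_coe_lt {p : ℝ} (h0 : 0 ≤ p) (h1 : p ≤ 1) :
    (volume : Measure unitInterval) {x | (x : ℝ) < p} = ENNReal.ofReal p :=
  unitInterval.volume_Iio ⟨p, h0, h1⟩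

/-- Logarithms of the rescaled weights give edge probabilities the form required by `sum_pairs_le`.
-/
theorem connProb_eq_exp {μ : ℝ} {n : ℕ} (hμ : 0 < μ * n) {x y : ℝ} (hx : 0 < x) (hy : 0 < y) :
    connProb μ n x y =
      Real.exp (min (Real.log (x / √(μ * n)) + Real.log (y / √(μ * n))) 0) := by
  have ht := Real.sqrt_pos.2 hμ
  rw [← Real.log_mul (by positivity) (by positivity), div_mul_div_comm, Real.mul_self_sqrt hμ.le,
    Real.exp_monotone.map_min, Real.exp_zero, Real.exp_log (by positivity), connProb]

/-- Given the weights, the probability that `s` spans a clique is at most a product over the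
vertices of `s`. -/
theorem pi_clique_le {μ : ℝ} {n : ℕ} (hμ : 0 < μ * n) {a b : ℝ} (hb : 0 ≤ b) (hba : b ≤ a)
    (ha : a ≤ 2) (hab : 2 * (a - 1) ≤ b) (hab' : a ≤ 2 * b) {h : Fin n → ℝ} (hh : ∀ i, 0 < h i)
    (s : Finset (Fin n)) (hs : 3 ≤ s.card) :
    (Measure.pi fun _ : Sym2 (Fin n) => (volume : Measure unitInterval))
        {u | (h, u) ∈ cliqueEvent μ n s} ≤
      ∏ i ∈ s, ENNReal.ofReal (min ((h i / √(μ * n)) ^ a) ((h i / √(μ * n)) ^ b)) := by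
  have ht := Real.sqrt_pos.2 hμ
  set t := √(μ * n) with ht_def
  set u : Fin n → ℝ := fun i => Real.log (h i / t) with hu
  let w : Sym2 (Fin n) → ℝ := Sym2.lift ⟨fun i j => min (u i + u j) 0, fun i j => by
    simp only [add_comm]⟩
  have hw : ∀ i j, w s(i, j) = min (u i + u j) 0 := fun i j => rfl
  have hw0 : ∀ e, w e ≤ 0 := fun e => by
    induction e with
    | _ i j => exact min_le_right _ _
  -- The clique event constrains only the marks of pairs inside `s`, so it lies in a box whose
  -- measure is the product of the edge probabilities.
  let B : Sym2 (Fin n) → Set unitInterval := fun e =>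
    if e ∈ pairs s then {x | (x : ℝ) < Real.exp (w e)} else Set.univ
  have hsub : {v | (h, v) ∈ cliqueEvent μ n s} ⊆ Set.univ.pi B := by
    intro v hv e _
    rw [Set.mem_ofPred_eq, mem_cliqueEvent] at hv
    by_cases he : e ∈ pairs s
    · simp only [B, if_pos he]
      induction e with
      | _ i j =>
        obtain ⟨hi, hj, hij⟩ := mk_mem_pairs.1 he
        have := hv i hi j hj hij
        rwa [connProb_eq_exp hμ (hh i) (hh j)] at this
    · simp only [B, if_neg he, Set.mem_univ]
  calc (Measure.pi fun _ : Sym2 (Fin n) => (volume : Measure unitInterval))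
        {v | (h, v) ∈ cliqueEvent μ n s}
      ≤ ∏ e, volume (B e) := (measure_mono hsub).trans_eq (Measure.pi_pi _ _)
    _ = ∏ e, if e ∈ pairs s then ENNReal.ofReal (Real.exp (w e)) else 1 := by
        refine Finset.prod_congr rfl fun e _ => ?_
        by_cases he : e ∈ pairs s
        · simp only [B, if_pos he]
          exact volume_coe_lt (Real.exp_pos _).le (Real.exp_le_one_iff.2 (hw0 e))
        · simp only [B, if_neg he, measure_univ]
    _ = ENNReal.ofReal (Real.exp (∑ e ∈ pairs s, w e)) := by
        rw [Finset.prod_ite_mem, Finset.univ_inter, Real.exp_sum,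
          ENNReal.ofReal_prod_of_nonneg fun e _ => (Real.exp_pos _).le]
    _ ≤ ENNReal.ofReal (Real.exp (∑ i ∈ s, min (a * u i) (b * u i))) :=
        ENNReal.ofReal_le_ofReal (Real.exp_le_exp.2
          (sum_pairs_le hb hba ha hab hab' u w hw hs s rfl))
    _ = _ := by
        rw [Real.exp_sum, ENNReal.ofReal_prod_of_nonneg fun e _ => (Real.exp_pos _).le]
        refine Finset.prod_congr rfl fun i _ => ?_
        have hpos : 0 < h i / t := div_pos (hh i) ht
        rw [Real.exp_monotone.map_min, Real.rpow_def_of_pos hpos, Real.rpow_def_of_pos hpos,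
          mul_comm a, mul_comm b]

/-- After conditioning on the weights, the bound is a product of functions of single weights, which
are independent. -/
theorem law_cliqueEvent_le {μ : ℝ} {n : ℕ} (hμ : 0 < μ * n) {a b : ℝ} (hb : 0 ≤ b) (hba : b ≤ a)
    (ha : a ≤ 2) (hab : 2 * (a - 1) ≤ b) (hab' : a ≤ 2 * b) (hν : ∀ᵐ h ∂ν, 0 < h)
    (s : Finset (Fin n)) (hs : 3 ≤ s.card) :
    law ν n (cliqueEvent μ n s) ≤
      (∫⁻ h, ENNReal.ofReal (min ((h / √(μ * n)) ^ a) ((h / √(μ * n)) ^ b)) ∂ν) ^ s.card := by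
  set g : ℝ → ENNReal := fun h =>
    ENNReal.ofReal (min ((h / √(μ * n)) ^ a) ((h / √(μ * n)) ^ b)) with hg
  have hgm : Measurable g := by
    refine Measurable.ennreal_ofReal (Measurable.min ?_ ?_)
    · exact (measurable_id.div_const _).pow_const a
    · exact (measurable_id.div_const _).pow_const b
  have hae : ∀ᵐ h ∂(Measure.pi fun _ : Fin n => ν), ∀ i, 0 < h i :=
    ae_all_iff.2 fun i => (Measure.quasiMeasurePreserving_eval (fun _ : Fin n => ν) i).ae hν
  rw [law, Measure.prod_apply (measurableSet_cliqueEvent μ n s)]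
  calc _ ≤ ∫⁻ h, ∏ i ∈ s, g (h i) ∂(Measure.pi fun _ : Fin n => ν) :=
        lintegral_mono_ae (hae.mono fun h hh =>
          pi_clique_le hμ hb hba ha hab hab' hh s hs)
    _ = ∏ i ∈ s, ∫⁻ h, g (h i) ∂(Measure.pi fun _ : Fin n => ν) :=
        ProbabilityTheory.lintegral_prod_eq_prod_lintegral_of_indepFun s
          (fun i (h : Fin n → ℝ) => g (h i))
          (ProbabilityTheory.iIndepFun_pi (X := fun _ => g) fun _ => hgm.aemeasurable)
          fun i => hgm.comp (measurable_pi_apply i)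
    _ = _ := by
        rw [← Finset.prod_const]
        refine Finset.prod_congr rfl fun i _ => ?_
        exact (measurePreserving_eval (fun _ : Fin n => ν) i).lintegral_comp hgm

/-- If all weights in `s` exceed `√(μ * n)`, every connection probability in `s` is one. The strict
inequality for the marks then excludes only the null event that some mark equals one. -/
theorem tail_pow_le_law_cliqueEvent {μ : ℝ} {n : ℕ} (hμ : 0 < μ * n) (s : Finset (Fin n)) :
    tail ν (√(μ * n)) ^ s.card ≤ (law ν n).real (cliqueEvent μ n s) := by
  have ht := Real.sqrt_pos.2 hμ
  set t := √(μ * n) with ht_def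
  have hsub : (Set.univ.pi fun i => if i ∈ s then Set.Ioi t else Set.univ) ×ˢ
      (Set.univ.pi fun _ : Sym2 (Fin n) => {x : unitInterval | (x : ℝ) < 1}) ⊆
        cliqueEvent μ n s := by
    rintro ⟨h, u⟩ ⟨hh, hu⟩
    have hht : ∀ i ∈ s, t < h i := fun i hi => by
      have := hh i (Set.mem_univ i)
      simpa only [if_pos hi, Set.mem_Ioi] using this
    refine mem_cliqueEvent.2 fun i hi j hj _ => (hu s(i, j) (Set.mem_univ _)).trans_le ?_
    refine le_min ?_ le_rfl
    rw [one_le_div hμ, ← Real.mul_self_sqrt hμ.le]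
    exact mul_le_mul (hht i hi).le (hht j hj).le ht.le (ht.trans (hht i hi)).le
  refine le_trans (le_of_eq ?_) (measureReal_mono hsub)
  have h1 : (volume : Measure unitInterval) {x | (x : ℝ) < 1} = 1 := by
    rw [volume_coe_lt zero_le_one le_rfl, ENNReal.ofReal_one]
  rw [measureReal_def, law, Measure.prod_prod, Measure.pi_pi, Measure.pi_pi]
  simp only [h1, Finset.prod_const_one, mul_one]
  simp only [apply_ite ν, measure_univ]
  rw [Finset.prod_ite_mem, Finset.univ_inter, Finset.prod_const, ENNReal.toReal_pow]
  rfl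

end Cliques

/-! ### Counting vertex sets and comparing tails. -/

section Asymptotics

theorem sameOrder_of_eventually {g₁ g₂ : ℕ → ℝ} {C₁ C₂ : ℝ} (hC₁ : 0 < C₁)
    (h : ∀ᶠ n in atTop, 0 < g₂ n ∧ C₁ * g₂ n ≤ g₁ n ∧ g₁ n ≤ C₂ * g₂ n) : SameOrder g₁ g₂ := by
  refine ⟨C₁, C₂, hC₁, ?_, liminf_le_limsup, ?_⟩
  · refine le_liminf_of_le (by isBoundedDefault) (h.mono fun n hn => ?_)
    exact EReal.coe_le_coe_iff.2 ((le_div_iff₀ hn.1).2 hn.2.1)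
  · refine limsup_le_of_le (by isBoundedDefault) (h.mono fun n hn => ?_)
    exact EReal.coe_le_coe_iff.2 ((div_le_iff₀ hn.1).2 hn.2.2)

theorem pow_div_le_choose {k n : ℕ} (hk : 1 ≤ k) (hn : 2 * k ≤ n) :
    (n : ℝ) ^ k / (2 ^ k * k.factorial) ≤ n.choose k := by
  refine le_trans ?_ (Nat.pow_le_choose k n)
  rw [← div_div, ← div_pow]
  gcongr
  rw [Nat.cast_sub (by omega)]
  have : 2 * (k : ℝ) ≤ n := by exact_mod_cast hn
  push_cast
  linarith

variable {ν : Measure ℝ} {τ : ℝ} {l : ℝ → ℝ}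

theorem eventually_tail_pos (hl : IsSlowlyVarying l)
    (htail : ∀ h : ℝ, 1 ≤ h → tail ν h = l h * h ^ (1 - τ)) : ∀ᶠ t in atTop, 0 < tail ν t := by
  obtain ⟨X, hX, -, hpos⟩ := hl.1
  filter_upwards [eventually_ge_atTop X, eventually_ge_atTop 1] with t h1 h2
  rw [htail t h2]
  exact mul_pos (hpos t h1) (Real.rpow_pos_of_pos (by linarith) _)

/-- The tail is regularly varying with exponent `1 - τ`. -/
theorem tendsto_tail_ratio (hl : IsSlowlyVarying l)
    (htail : ∀ h : ℝ, 1 ≤ h → tail ν h = l h * h ^ (1 - τ)) {c : ℝ} (hc : 0 < c) :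
    Tendsto (fun t => tail ν (c * t) / tail ν t) atTop (𝓝 (c ^ (1 - τ))) := by
  have h := (hl.2 c hc).mul_const (c ^ (1 - τ))
  rw [one_mul] at h
  refine h.congr' ?_
  filter_upwards [eventually_ge_atTop 1, eventually_ge_atTop (1 / c)] with t h1 h2
  have ht : 0 < t := by linarith
  have hct : 1 ≤ c * t := by rwa [div_le_iff₀ hc, mul_comm] at h2
  rw [htail t h1, htail _ hct, Real.mul_rpow hc.le ht.le]
  have := (Real.rpow_pos_of_pos ht (1 - τ)).ne'
  rw [← mul_assoc, mul_div_mul_right _ _ this]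
  ring

theorem pow_mul_tail_sqrt (htail : ∀ h : ℝ, 1 ≤ h → tail ν h = l h * h ^ (1 - τ)) (k : ℕ) {n : ℕ}
    (hn : 1 ≤ n) :
    (n : ℝ) ^ k * tail ν √n ^ k = (n : ℝ) ^ ((k : ℝ) * (3 - τ) / 2) * l √n ^ k := by
  have hn1 : (1 : ℝ) ≤ n := by exact_mod_cast hn
  have hn0 : (0 : ℝ) < n := by linarith
  rw [htail _ (Real.one_le_sqrt.2 hn1), mul_pow, Real.sqrt_eq_rpow, ← Real.rpow_mul hn0.le,
    ← Real.rpow_natCast (_ ^ _) k, ← Real.rpow_mul hn0.le, ← Real.rpow_natCast (n : ℝ) k,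
    mul_left_comm, ← Real.rpow_add hn0, mul_comm]
  congr 2
  ring

theorem avgCliques_sameOrder [IsProbabilityMeasure ν] (hτ₂ : 2 < τ) (hτ₃ : τ < 3)
    (hl : IsSlowlyVarying l) (hν : ∀ᵐ h ∂ν, 1 ≤ h)
    (htail : ∀ h : ℝ, 1 ≤ h → tail ν h = l h * h ^ (1 - τ)) {k : ℕ}
    (hk : 3 ≤ k) :
    SameOrder (fun n => avgCliques ν k n) (fun n => (n : ℝ) ^ k * tail ν √n ^ k) := by
  have hν0 : ∀ᵐ h ∂ν, 0 < h := hν.mono fun h hh => one_pos.trans_le hh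
  have hpos := eventually_tail_pos hl htail
  have hlim : Tendsto (fun t => tail ν (2 * t) / tail ν t) atTop (𝓝 ((2 : ℝ) ^ (-(τ - 1)))) := by
    rw [neg_sub]
    exact tendsto_tail_ratio hl htail two_pos
  -- Without integrability the Bochner integral defining `meanWeight` would default to zero, and `1
  -- ≤ μ` would fail.
  have hint : Integrable (fun h : ℝ => h) ν :=
    integrable_id_of_tail (by linarith) hν0 hpos hlim
  set μ := meanWeight ν with hμ
  have hμ1 : 1 ≤ μ := by
    have := integral_mono_ae (integrable_const (1 : ℝ)) hint hν
    rw [integral_const, probReal_univ, one_smul] at this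
    exact this
  have hμ0 : 0 < μ := by linarith
  -- The largest `δ` with `2 * (a - 1) ≤ b` for `a = τ - 1 + δ` and `b = τ - 1 - δ`; then `a ≤ 2`
  -- follows from `τ < 3`, and `a ≤ 2 * b` from `2 < τ`.
  set δ : ℝ := (3 - τ) / 3 with hδ
  obtain ⟨K, hK, hup⟩ := exists_lintegral_min_rpow_le (a := τ - 1 + δ) (b := τ - 1 - δ)
    (by rw [hδ]; linarith) (by rw [hδ]; linarith) (by rw [hδ]; linarith) hν0 hpos hlim
  have hsqrt : Tendsto (fun n : ℕ => √(n : ℝ)) atTop atTop :=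
    Real.tendsto_sqrt_atTop.comp tendsto_natCast_atTop_atTop
  have hsqrtμ : Tendsto (fun n : ℕ => √(μ * n)) atTop atTop :=
    Real.tendsto_sqrt_atTop.comp (tendsto_natCast_atTop_atTop.const_mul_atTop hμ0)
  -- Half the limit of `tail ν (√μ * t) / tail ν t`, so that the ratio eventually exceeds `c`.
  set c : ℝ := √μ ^ (1 - τ) / 2 with hc
  have hcμ : 0 < √μ ^ (1 - τ) := Real.rpow_pos_of_pos (Real.sqrt_pos.2 hμ0) _
  have hc0 : 0 < c := by positivity
  have hlow : ∀ᶠ t in atTop, c < tail ν (√μ * t) / tail ν t :=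
    (tendsto_tail_ratio hl htail (Real.sqrt_pos.2 hμ0)).eventually
      (lt_mem_nhds (by rw [hc]; linarith))
  refine sameOrder_of_eventually (C₁ := c ^ k / (2 ^ k * k.factorial)) (C₂ := K ^ k)
    (by positivity) ?_
  filter_upwards [hsqrt.eventually hpos, hsqrt.eventually hlow, hsqrtμ.eventually hup,
    eventually_ge_atTop (2 * k)] with n hG hlown hupn hn
  have hn0 : (0 : ℝ) < n := by exact_mod_cast (show 0 < n by omega)
  have hμn : 0 < μ * n := by positivity
  have hcard : ∀ s ∈ Finset.powersetCard k (Finset.univ : Finset (Fin n)), s.card = k :=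
    fun s hs => (Finset.mem_powersetCard.1 hs).2
  have hnum : (Finset.powersetCard k (Finset.univ : Finset (Fin n))).card = n.choose k := by
    rw [Finset.card_powersetCard, Finset.card_univ, Fintype.card_fin]
  refine ⟨by positivity, ?_, ?_⟩
  · have hle : c * tail ν √n ≤ tail ν √(μ * n) := by
      rw [Real.sqrt_mul hμ0.le]
      exact ((lt_div_iff₀ hG).1 hlown).le
    calc c ^ k / (2 ^ k * k.factorial) * ((n : ℝ) ^ k * tail ν √n ^ k)
        = (n : ℝ) ^ k / (2 ^ k * k.factorial) * (c * tail ν √n) ^ k := by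
          rw [mul_pow]; ring
      _ ≤ n.choose k * tail ν √(μ * n) ^ k := by
          gcongr
          exact pow_div_le_choose (by omega) hn
      _ = ∑ _s ∈ Finset.powersetCard k (Finset.univ : Finset (Fin n)), tail ν √(μ * n) ^ k := by
          rw [Finset.sum_const, hnum, nsmul_eq_mul]
      _ ≤ avgCliques ν k n := by
          rw [avgCliques_eq_sum]
          refine Finset.sum_le_sum fun s hs => ?_
          have := tail_pow_le_law_cliqueEvent (ν := ν) hμn s
          rwa [hcard s hs] at this
  · have hle : tail ν √(μ * n) ≤ tail ν √n :=
      tail_antitone (Real.sqrt_le_sqrt (le_mul_of_one_le_left hn0.le hμ1))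
    have hev : ∀ s ∈ Finset.powersetCard k (Finset.univ : Finset (Fin n)),
        (law ν n).real (cliqueEvent μ n s) ≤ (K * tail ν √n) ^ k := by
      intro s hs
      refine ENNReal.toReal_le_of_le_ofReal (by positivity) ?_
      refine (law_cliqueEvent_le (a := τ - 1 + δ) (b := τ - 1 - δ) hμn (by rw [hδ]; linarith)
        (by rw [hδ]; linarith) (by rw [hδ]; linarith) (by rw [hδ]; linarith)
        (by rw [hδ]; linarith) hν0 s (by rw [hcard s hs]; exact hk)).trans ?_
      rw [hcard s hs, ENNReal.ofReal_pow (by positivity)]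
      gcongr
      exact hupn.trans (ENNReal.ofReal_le_ofReal (by gcongr))
    calc avgCliques ν k n
        ≤ ∑ _s ∈ Finset.powersetCard k (Finset.univ : Finset (Fin n)), (K * tail ν √n) ^ k := by
          rw [avgCliques_eq_sum]
          exact Finset.sum_le_sum hev
      _ = n.choose k * (K * tail ν √n) ^ k := by
          rw [Finset.sum_const, hnum, nsmul_eq_mul]
      _ ≤ (n : ℝ) ^ k * (K * tail ν √n) ^ k := by
          gcongr
          exact_mod_cast Nat.choose_le_pow n k
      _ = K ^ k * ((n : ℝ) ^ k * tail ν √n ^ k) := by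
          rw [mul_pow]; ring

end Asymptotics

end RankOneGraph

end

theorem theorem2p1 (τ : ℝ) (hτ₂ : 2 < τ) (hτ₃ : τ < 3)
    (l : ℝ → ℝ) (hl : RankOneGraph.IsSlowlyVarying l)
    (ν : MeasureTheory.Measure ℝ) [MeasureTheory.IsProbabilityMeasure ν]
    (hν : ∀ᵐ h ∂ν, 1 ≤ h)
    (htail : ∀ h : ℝ, 1 ≤ h → RankOneGraph.tail ν h = l h * h ^ (1 - τ))
    (k : ℕ) (hk : 3 ≤ k) :
    RankOneGraph.SameOrder (fun n => RankOneGraph.avgCliques ν k n)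
        (fun n => (n : ℝ) ^ k * RankOneGraph.tail ν (Real.sqrt n) ^ k) ∧
      ∀ n : ℕ, 1 ≤ n →
        (n : ℝ) ^ k * RankOneGraph.tail ν (Real.sqrt n) ^ k =
          (n : ℝ) ^ ((k : ℝ) * (3 - τ) / 2) * l (Real.sqrt n) ^ k :=
  ⟨RankOneGraph.avgCliques_sameOrder hτ₂ hτ₃ hl hν htail hk,
    fun _ hn => RankOneGraph.pow_mul_tail_sqrt htail k hn⟩
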